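/- Let $\mathcal{C}$ be a regular category, i.e. a finitely complete category in which every kernel pair has a coequaliser and regular epimorphisms are stable under pullback (equivalently, a finitely complete category in which every morphism factors as a regular epimorphism followed by a monomorphism, and regular epimorphisms are stable under pullback). For relations $R \rightarrowtail X \times Y$ and $S \rightarrowtail Y \times Z$ in a regular category, let $S \circ R \rightarrowtail X \times Z$ be the image of the canonical morphism $R \times_Y S \to X \times Z$. A regular category is called a Goursat category if $S \circ R \circ S = R \circ S \circ R$ for all internal equivalence relations $R, S$ on the same object. Let $\mathrm{Gpd}(\mathcal{C})$ be the category of internal groupoids in $\mathcal{C}$ (objects $X_0$, $X_1$ with source and target maps $s,t\colon X_1\to X_0$, identities $u\colon X_0\to X_1$, composition $m\colon X_1\times_{X_0}X_1\to X_1$ defined on the pullback of $s$ and $t$, and inversion $i\colon X_1\to X_1$, satisfying the usual groupoid axioms) and internal functors between them (pairs $f_0\colon X_0\to Y_0$, $f_1\colon X_1\to Y_1$ compatible with this structure). Then $\mathcal{C}$ is a Goursat category if and only if $\mathrm{Gpd}(\mathcal{C})$ is a regular category and is a Goursat category. -/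

import Mathlib

open CategoryTheory CategoryTheory.Limits

universe v u

/-- An internal groupoid in a category with pullbacks: an object `X₀` of objects, an object `X₁` of
morphisms, source, target and identity maps, a composition map `m` defined on the object of
composable pairs `(g, f)` with `s g = t f` (so that `m (g, f)` is `g ∘ f`), and an inversion map. -/
structure InternalGroupoid (C : Type u) [Category.{v} C] [HasPullbacks C] where
  /-- the object of objects -/
  X₀ : C
  /-- the object of morphisms -/
  X₁ : C
  /-- source -/
  s : X₁ ⟶ X₀
  /-- target -/
  t : X₁ ⟶ X₀
  /-- identities -/
  u : X₀ ⟶ X₁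
  /-- composition of composable pairs -/
  m : pullback s t ⟶ X₁
  /-- inversion -/
  i : X₁ ⟶ X₁
  u_s : u ≫ s = 𝟙 X₀
  u_t : u ≫ t = 𝟙 X₀
  m_s : m ≫ s = pullback.snd s t ≫ s
  m_t : m ≫ t = pullback.fst s t ≫ t
  /-- `f ∘ id = f` -/
  m_u : pullback.lift (𝟙 X₁) (s ≫ u) (by simp [u_t]) ≫ m = 𝟙 X₁
  /-- `id ∘ f = f` -/
  u_m : pullback.lift (t ≫ u) (𝟙 X₁) (by simp [u_s]) ≫ m = 𝟙 X₁
  /-- `(h ∘ g) ∘ f = h ∘ (g ∘ f)`, for all generalised elements `h`, `g`, `f` of `X₁`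
  with `s h = t g` and `s g = t f` -/
  assoc : ∀ {T : C} (h g f : T ⟶ X₁) (hg : h ≫ s = g ≫ t) (gf : g ≫ s = f ≫ t),
    pullback.lift (pullback.lift h g hg ≫ m) f
        (by rw [Category.assoc, m_s, pullback.lift_snd_assoc, gf]) ≫ m =
      pullback.lift h (pullback.lift g f gf ≫ m)
        (by rw [Category.assoc, m_t, pullback.lift_fst_assoc, hg]) ≫ m
  i_s : i ≫ s = t
  i_t : i ≫ t = s
  /-- `f ∘ f⁻¹ = id` -/
  m_i : pullback.lift (𝟙 X₁) i (by simp [i_t]) ≫ m = t ≫ u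
  /-- `f⁻¹ ∘ f = id` -/
  i_m : pullback.lift i (𝟙 X₁) (by simp [i_s]) ≫ m = s ≫ u

namespace InternalGroupoid

variable {C : Type u} [Category.{v} C] [HasPullbacks C]

/-- An internal functor between internal groupoids: a morphism on objects and a morphism on
morphisms, compatible with source, target, identities and composition. -/
@[ext]
structure Hom (A B : InternalGroupoid C) where
  /-- the component on objects -/
  f₀ : A.X₀ ⟶ B.X₀
  /-- the component on morphisms -/
  f₁ : A.X₁ ⟶ B.X₁
  s_comm : A.s ≫ f₀ = f₁ ≫ B.s
  t_comm : A.t ≫ f₀ = f₁ ≫ B.t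
  u_comm : A.u ≫ f₁ = f₀ ≫ B.u
  m_comm : A.m ≫ f₁ =
    pullback.map A.s A.t B.s B.t f₁ f₁ f₀ s_comm t_comm ≫ B.m

/-- The category `Gpd(C)` of internal groupoids and internal functors in `C`. -/
instance : Category.{v} (InternalGroupoid C) where
  Hom A B := Hom A B
  id A :=
    { f₀ := 𝟙 _
      f₁ := 𝟙 _
      s_comm := by simp
      t_comm := by simp
      u_comm := by simp
      m_comm := by simp }
  comp {A B D} F G :=
    { f₀ := F.f₀ ≫ G.f₀
      f₁ := F.f₁ ≫ G.f₁
      s_comm := by rw [← Category.assoc, F.s_comm, Category.assoc, G.s_comm, Category.assoc]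
      t_comm := by rw [← Category.assoc, F.t_comm, Category.assoc, G.t_comm, Category.assoc]
      u_comm := by rw [← Category.assoc, F.u_comm, Category.assoc, G.u_comm, Category.assoc]
      m_comm := by
        rw [← Category.assoc, F.m_comm, Category.assoc, G.m_comm, ← Category.assoc]
        congr 1
        apply pullback.hom_ext <;>
          simp [pullback.map, pullback.lift_fst, pullback.lift_snd, pullback.lift_fst_assoc,
            pullback.lift_snd_assoc] }
  id_comp F := Hom.ext (Category.id_comp _) (Category.id_comp _)
  comp_id F := Hom.ext (Category.comp_id _) (Category.comp_id _)
  assoc F G H := Hom.ext (Category.assoc _ _ _) (Category.assoc _ _ _)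

end InternalGroupoid

section Relations

variable {C : Type u} [Category.{v} C] [Regular C]

/-- The composite `S ∘ R` of relations `R ↣ X ⨯ Y` and `S ↣ Y ⨯ Z` in a regular category: the image
of the canonical morphism `R ×_Y S ⟶ X ⨯ Z`. -/
noncomputable def relComp {X Y Z : C} (S : Subobject (Y ⨯ Z)) (R : Subobject (X ⨯ Y)) :
    Subobject (X ⨯ Z) :=
  imageSubobject (prod.lift
    (pullback.fst (R.arrow ≫ prod.snd) (S.arrow ≫ prod.fst) ≫ R.arrow ≫ prod.fst)
    (pullback.snd (R.arrow ≫ prod.snd) (S.arrow ≫ prod.fst) ≫ S.arrow ≫ prod.snd))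

/-- A relation `R ↣ X ⨯ X` is an (internal) equivalence relation. -/
def IsEquivRel {X : C} (R : Subobject (X ⨯ X)) : Prop :=
  IsEquivalenceRelation (R.arrow ≫ prod.fst) (R.arrow ≫ prod.snd)

end Relations

/-- A regular category is a Goursat category if it is 3-permutable: `S ∘ R ∘ S = R ∘ S ∘ R` for any
two equivalence relations `R`, `S` on the same object. -/
def IsGoursat (C : Type u) [Category.{v} C] [Regular C] : Prop :=
  ∀ ⦃X : C⦄ (R S : Subobject (X ⨯ X)), IsEquivRel R → IsEquivRel S →
    relComp S (relComp R S) = relComp R (relComp S R)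

/-!
The argument uses generalized elements: a property involving images holds for generalized elements
`T ⟶ X` after precomposition with a regular epimorphism `T' ⟶ T` (a cover). In this language
(`isGoursat_iff`) the Goursat property says that a chain `x R y S z R w` can be replaced, over a
cover, by a chain `x S y' R z' S w`.

Suppose that `C` is a Goursat category. Finite limits of internal groupoids are computed
componentwise. The key point is `IsGoursat.exists_kernelPair_lift`: for a morphism of split
epimorphisms from `s` to `s'` whose domain part `e₁` is a quotient map, the kernel pair of `s`
covers the kernel pair of `s'`. Applied to the source maps of a groupoid `A` and of a reflexive
graph with inversion `I` that is a componentwise quotient of `A`, it shows that composable pairs of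
`I` lift to composable pairs of `A` (`IsGoursat.exists_composable_lift`). Consequently the
componentwise image of an internal functor is closed under composition (`exists_image_fac`), and a
functor that is componentwise a regular epimorphism is a coequalizer of its kernel pair
(`isRegularEpi_of_components`). Regular epimorphisms of internal groupoids are therefore exactly
the componentwise ones, whence regularity of the category of internal groupoids, and the Goursat
property can be checked on the two components (`IsGoursat.isRegularEpi_map_chains`).

Conversely, the object-of-objects functor has a right adjoint, the codiscrete groupoid functor.
The latter preserves finite limits, hence equivalence relations, and the former preserves regular
epimorphisms, so the Goursat property of internal groupoids descends to `C`.
-/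

/-! ### Regular epimorphisms and images in a regular category -/

section RegularEpi

lemma exists_diagonal_of_regularEpi_mono {C : Type u} [Category.{v} C] {A B X Y : C}
    {e : A ⟶ B} {n : X ⟶ Y} (he : IsRegularEpi e) [Mono n] (a : A ⟶ X) (b : B ⟶ Y)
    (h : a ≫ n = e ≫ b) :
    ∃ d : B ⟶ X, e ≫ d = a ∧ d ≫ n = b :=
  have sq : CommSq a e n b := ⟨h⟩
  ⟨sq.lift, sq.fac_left, sq.fac_right⟩

variable {C : Type u} [Category.{v} C] [Regular C]

lemma isRegularEpi_comp {X Y Z : C} (f : X ⟶ Y) (g : Y ⟶ Z) (hf : IsRegularEpi f)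
    (hg : IsRegularEpi g) : IsRegularEpi (f ≫ g) := by
  have := strongEpi_comp f g
  infer_instance

lemma isRegularEpi_of_comp {X Y Z : C} (f : X ⟶ Y) (g : Y ⟶ Z) (h : IsRegularEpi (f ≫ g)) :
    IsRegularEpi g := by
  have := strongEpi_of_strongEpi f g
  infer_instance

lemma exists_regularEpi_mono_fac {X Y : C} (f : X ⟶ Y) :
    ∃ (I : C) (e : X ⟶ I) (n : I ⟶ Y), IsRegularEpi e ∧ Mono n ∧ e ≫ n = f :=
  ⟨_, (Regular.strongEpiMonoFactorisation f).e, (Regular.strongEpiMonoFactorisation f).m,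
    inferInstance, inferInstance, (Regular.strongEpiMonoFactorisation f).fac⟩

/-- A regular epimorphism lifts every generalized element, after passing to a cover. -/
lemma exists_cover_lift {A B : C} {e : A ⟶ B} (he : IsRegularEpi e) {T : C} (b : T ⟶ B) :
    ∃ (T' : C) (c : T' ⟶ T) (a : T' ⟶ A), IsRegularEpi c ∧ a ≫ e = c ≫ b :=
  ⟨_, pullback.snd e b, pullback.fst e b, inferInstance, pullback.condition⟩

lemma exists_desc_of_regularEpi {A B Z : C} {e : A ⟶ B} (he : IsRegularEpi e) (k : A ⟶ Z)
    (h : pullback.fst e e ≫ k = pullback.snd e e ≫ k) : ∃ l : B ⟶ Z, e ≫ l = k :=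
  ⟨IsRegularEpi.desc e k (by
    rw [← pullback.lift_fst _ _ (IsRegularEpi.w e), Category.assoc, h,
      pullback.lift_snd_assoc]), IsRegularEpi.fac _ _ _⟩

lemma imageSubobject_factors_iff {X Y T : C} (f : X ⟶ Y) (t : T ⟶ Y) :
    (imageSubobject f).Factors t ↔
      ∃ (T' : C) (e : T' ⟶ T) (x : T' ⟶ X), IsRegularEpi e ∧ x ≫ f = e ≫ t := by
  constructor
  · intro h
    have he : IsRegularEpi (factorThruImageSubobject f) := by
      rw [factorThruImageSubobject]
      have : StrongEpi (factorThruImage f ≫ (imageSubobjectIso f).inv) := strongEpi_comp _ _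
      infer_instance
    obtain ⟨T', e, x, he', hx⟩ := exists_cover_lift he ((imageSubobject f).factorThru t h)
    refine ⟨T', e, x, he', ?_⟩
    have := congr($hx ≫ (imageSubobject f).arrow)
    simpa using this
  · rintro ⟨T', e, x, he, hx⟩
    obtain ⟨d, -, hd⟩ := exists_diagonal_of_regularEpi_mono (n := (imageSubobject f).arrow) he
      (x ≫ factorThruImageSubobject f) t (by simpa using hx)
    exact (Subobject.factors_iff _ _).2 ⟨d, hd⟩

end RegularEpi

/-! ### Relations on generalized elements -/

section Related

lemma prod_lift_ext_iff {C : Type u} [Category.{v} C] [HasBinaryProducts C] {X Y T : C}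
    {f : T ⟶ X ⨯ Y} {x : T ⟶ X} {y : T ⟶ Y} :
    f = prod.lift x y ↔ f ≫ prod.fst = x ∧ f ≫ prod.snd = y := by
  constructor
  · rintro rfl
    exact ⟨prod.lift_fst _ _, prod.lift_snd _ _⟩
  · rintro ⟨rfl, rfl⟩
    apply prod.hom_ext
    · rw [prod.lift_fst]
    · rw [prod.lift_snd]

variable {C : Type u} [Category.{v} C]

/-- The generalized elements `x`, `y` of `X` and `Y` are related by the span `p : R ⟶ X`,
`q : R ⟶ Y`. -/
def Related {R X Y T : C} (p : R ⟶ X) (q : R ⟶ Y) (x : T ⟶ X) (y : T ⟶ Y) : Prop :=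
  ∃ r : T ⟶ R, r ≫ p = x ∧ r ≫ q = y

lemma Related.precomp {R X Y T T' : C} {p : R ⟶ X} {q : R ⟶ Y} {x : T ⟶ X} {y : T ⟶ Y}
    (h : Related p q x y) (e : T' ⟶ T) : Related p q (e ≫ x) (e ≫ y) := by
  obtain ⟨r, rfl, rfl⟩ := h
  exact ⟨e ≫ r, by simp, by simp⟩

section IsEquivalenceRelation

variable {R X T : C} {p q : R ⟶ X}

lemma CategoryTheory.IsEquivalenceRelation.jointlyMono (h : IsEquivalenceRelation p q) :
    JointlyMono₂ p q :=
  h.nonempty_equivalenceRelation.some.toReflexiveRelation.toJointlyMono₂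

lemma CategoryTheory.IsEquivalenceRelation.mono_prod_lift [HasBinaryProducts C]
    (h : IsEquivalenceRelation p q) : Mono (prod.lift p q) :=
  ⟨fun f g hfg => by
    rw [prod.comp_lift g, prod_lift_ext_iff, Category.assoc, prod.lift_fst, Category.assoc,
      prod.lift_snd] at hfg
    exact h.jointlyMono.right_cancellation _ _ hfg.1 hfg.2⟩

lemma CategoryTheory.IsEquivalenceRelation.refl (h : IsEquivalenceRelation p q) (x : T ⟶ X) :
    Related p q x x := by
  obtain ⟨⟨e⟩⟩ := h
  exact ⟨x ≫ e.r, by simp, by simp⟩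

lemma CategoryTheory.IsEquivalenceRelation.symm (h : IsEquivalenceRelation p q) {x y : T ⟶ X}
    (hxy : Related p q x y) : Related p q y x := by
  obtain ⟨⟨e⟩⟩ := h
  obtain ⟨r, rfl, rfl⟩ := hxy
  exact ⟨r ≫ e.s, by rw [Category.assoc, e.symmetry₁], by rw [Category.assoc, e.symmetry₂]⟩

lemma CategoryTheory.IsEquivalenceRelation.trans (h : IsEquivalenceRelation p q) {x y z : T ⟶ X}
    (hxy : Related p q x y) (hyz : Related p q y z) : Related p q x z := by
  obtain ⟨⟨e⟩⟩ := h
  obtain ⟨r, rfl, rfl⟩ := hxy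
  obtain ⟨r', h', rfl⟩ := hyz
  refine ⟨PullbackCone.IsLimit.lift e.isLimit r r' h'.symm ≫ e.t, ?_, ?_⟩
  · rw [Category.assoc, e.transitivity₁, PullbackCone.IsLimit.lift_fst_assoc]
  · rw [Category.assoc, e.transitivity₂, PullbackCone.IsLimit.lift_snd_assoc]

lemma isEquivalenceRelation_of_related [HasPullbacks C] (hj : JointlyMono₂ p q)
    (hr : ∀ {T : C} (x : T ⟶ X), Related p q x x)
    (hs : ∀ {T : C} {x y : T ⟶ X}, Related p q x y → Related p q y x)
    (ht : ∀ {T : C} {x y z : T ⟶ X}, Related p q x y → Related p q y z → Related p q x z) :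
    IsEquivalenceRelation p q := by
  obtain ⟨r, r₁, r₂⟩ := hr (𝟙 X)
  obtain ⟨s, s₁, s₂⟩ := hs ⟨𝟙 R, Category.id_comp p, Category.id_comp q⟩
  obtain ⟨t, t₁, t₂⟩ := ht ⟨pullback.fst q p, rfl, rfl⟩
    ⟨pullback.snd q p, pullback.condition.symm, rfl⟩
  exact ⟨⟨{ hj with
    r := r
    reflexivity₁ := r₁
    reflexivity₂ := r₂
    s := s
    symmetry₁ := s₁
    symmetry₂ := s₂
    c := _
    isLimit := pullbackIsPullback q p
    t := t
    transitivity₁ := t₁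
    transitivity₂ := t₂ }⟩⟩

/-- Being an equivalence relation only depends on the relation induced on generalized elements. -/
lemma isEquivalenceRelation_congr [HasPullbacks C] {R' : C} {p' q' : R' ⟶ X}
    (h : IsEquivalenceRelation p q) (hj : JointlyMono₂ p' q')
    (hR : ∀ {T : C} (x y : T ⟶ X), Related p' q' x y ↔ Related p q x y) :
    IsEquivalenceRelation p' q' :=
  isEquivalenceRelation_of_related hj (fun x => (hR x x).2 (h.refl x))
    (fun hxy => (hR _ _).2 (h.symm ((hR _ _).1 hxy)))
    (fun hxy hyz => (hR _ _).2 (h.trans ((hR _ _).1 hxy) ((hR _ _).1 hyz)))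

lemma isEquivalenceRelation_pullback [HasPullbacks C] {Y : C} (f : X ⟶ Y) :
    IsEquivalenceRelation (pullback.fst f f) (pullback.snd f f) :=
  ((IsKernelPair.of_hasPullback f).equivalenceRelation f _ _
    (pullbackIsPullback _ _)).isEquivalenceRelation

lemma related_pullback_iff [HasPullbacks C] {Y : C} (f : X ⟶ Y) (x y : T ⟶ X) :
    Related (pullback.fst f f) (pullback.snd f f) x y ↔ x ≫ f = y ≫ f := by
  constructor
  · rintro ⟨r, rfl, rfl⟩
    simp [pullback.condition]
  · exact fun h => ⟨pullback.lift x y h, pullback.lift_fst _ _ _, pullback.lift_snd _ _ _⟩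

end IsEquivalenceRelation

lemma factors_iff_related [HasBinaryProducts C] {X Y T : C} (R : Subobject (X ⨯ Y)) (x : T ⟶ X)
    (y : T ⟶ Y) : R.Factors (prod.lift x y) ↔
      Related (R.arrow ≫ prod.fst) (R.arrow ≫ prod.snd) x y := by
  have h : R.Factors (prod.lift x y) ↔ ∃ r : T ⟶ (R : C), r ≫ R.arrow = prod.lift x y :=
    Subobject.factors_iff _ _
  simp only [h, prod_lift_ext_iff, Category.assoc, Related]

end Related

/-! ### Goursat categories in terms of generalized elements -/

section Goursat

variable {C : Type u} [Category.{v} C] [Regular C]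

lemma relComp_factors_iff {X Y Z T : C} (S : Subobject (Y ⨯ Z)) (R : Subobject (X ⨯ Y))
    (x : T ⟶ X) (z : T ⟶ Z) : (relComp S R).Factors (prod.lift x z) ↔
      ∃ (T' : C) (e : T' ⟶ T) (y : T' ⟶ Y), IsRegularEpi e ∧
        R.Factors (prod.lift (e ≫ x) y) ∧ S.Factors (prod.lift y (e ≫ z)) := by
  simp only [factors_iff_related]
  rw [← factors_iff_related, relComp, imageSubobject_factors_iff]
  constructor
  · rintro ⟨T', e, w, he, hw⟩
    rw [prod.comp_lift, prod.comp_lift, prod_lift_ext_iff, prod.lift_fst, prod.lift_snd] at hw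
    refine ⟨T', e, w ≫ pullback.fst _ _ ≫ R.arrow ≫ prod.snd, he,
      ⟨w ≫ pullback.fst _ _, by simpa using hw.1, by simp⟩,
      ⟨w ≫ pullback.snd _ _, ?_, by simpa using hw.2⟩⟩
    rw [pullback.condition, Category.assoc]
  · rintro ⟨T', e, y, he, ⟨r, h₁, h₂⟩, ⟨s, h₃, h₄⟩⟩
    refine ⟨T', e, pullback.lift r s (h₂.trans h₃.symm), he, ?_⟩
    rw [prod.comp_lift, prod.comp_lift, pullback.lift_fst_assoc, pullback.lift_snd_assoc, h₁, h₄]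

lemma subobject_le_of_factors {X Y : C} {R S : Subobject (X ⨯ Y)}
    (h : ∀ {T : C} (x : T ⟶ X) (y : T ⟶ Y), R.Factors (prod.lift x y) →
      S.Factors (prod.lift x y)) : R ≤ S := by
  have h' := h (R.arrow ≫ prod.fst) (R.arrow ≫ prod.snd)
  rw [← prod_lift_ext_iff.2 ⟨rfl, rfl⟩] at h'
  exact Subobject.le_of_factors (h' (Subobject.factors_self R))

lemma relComp_relComp_factors_iff {X : C} (S R : Subobject (X ⨯ X)) {T : C} (x w : T ⟶ X) :
    (relComp S (relComp R S)).Factors (prod.lift x w) ↔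
      ∃ (T' : C) (e : T' ⟶ T) (y z : T' ⟶ X), IsRegularEpi e ∧
        S.Factors (prod.lift (e ≫ x) y) ∧ R.Factors (prod.lift y z) ∧
          S.Factors (prod.lift z (e ≫ w)) := by
  rw [relComp_factors_iff]
  constructor
  · rintro ⟨T', e, z, he, h, hz⟩
    obtain ⟨T'', e', y, he', h₁, h₂⟩ := (relComp_factors_iff _ _ _ _).1 h
    refine ⟨T'', e' ≫ e, y, e' ≫ z, isRegularEpi_comp _ _ he' he, by simpa using h₁, h₂, ?_⟩
    rw [factors_iff_related] at hz ⊢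
    simpa using hz.precomp e'
  · rintro ⟨T', e, y, z, he, h₁, h₂, h₃⟩
    refine ⟨T', e, z, he, (relComp_factors_iff _ _ _ _).2 ⟨T', 𝟙 _, y, inferInstance, ?_, ?_⟩, h₃⟩
    · simpa using h₁
    · simpa using h₂

/-- The Goursat property in terms of generalized elements: a chain `x R y S z R w` can, after
passing to a cover, be replaced by a chain `x S y' R z' S w`. -/
theorem isGoursat_iff : IsGoursat C ↔ ∀ ⦃X R S : C⦄ (p₁ p₂ : R ⟶ X) (q₁ q₂ : S ⟶ X),
    IsEquivalenceRelation p₁ p₂ → IsEquivalenceRelation q₁ q₂ →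
    ∀ ⦃T : C⦄ (x y z w : T ⟶ X), Related p₁ p₂ x y → Related q₁ q₂ y z → Related p₁ p₂ z w →
    ∃ (T' : C) (e : T' ⟶ T) (y' z' : T' ⟶ X), IsRegularEpi e ∧
      Related q₁ q₂ (e ≫ x) y' ∧ Related p₁ p₂ y' z' ∧ Related q₁ q₂ z' (e ≫ w) := by
  constructor
  · intro h X R S p₁ p₂ q₁ q₂ hp hq T x y z w hxy hyz hzw
    -- an internal relation given by a jointly monic span is represented by a subobject
    have key : ∀ {R : C} (p₁ p₂ : R ⟶ X), IsEquivalenceRelation p₁ p₂ →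
        ∃ P : Subobject (X ⨯ X), IsEquivRel P ∧ ∀ {T : C} (x y : T ⟶ X),
          P.Factors (prod.lift x y) ↔ Related p₁ p₂ x y := by
      intro R p₁ p₂ hp
      have := hp.mono_prod_lift
      have hP : ∀ {T : C} (x y : T ⟶ X), (Subobject.mk (prod.lift p₁ p₂)).Factors (prod.lift x y) ↔
          Related p₁ p₂ x y := by
        intro T x y
        have h' : (Subobject.mk (prod.lift p₁ p₂)).Factors (prod.lift x y) ↔
            ∃ r : T ⟶ R, r ≫ prod.lift p₁ p₂ = prod.lift x y := Subobject.mk_factors_iff _ _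
        simp only [h', prod_lift_ext_iff, Category.assoc, prod.lift_fst, prod.lift_snd, Related]
      refine ⟨Subobject.mk (prod.lift p₁ p₂), ?_, hP⟩
      refine isEquivalenceRelation_congr hp ⟨fun T f g h₁ h₂ => ?_⟩ fun x y => ?_
      · rw [← cancel_mono (Subobject.mk (prod.lift p₁ p₂)).arrow]
        ext <;> simpa
      · rw [← factors_iff_related, hP]
    obtain ⟨P, hP, hP'⟩ := key p₁ p₂ hp
    obtain ⟨Q, hQ, hQ'⟩ := key q₁ q₂ hq
    have hx : (relComp P (relComp Q P)).Factors (prod.lift x w) :=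
      (relComp_relComp_factors_iff _ _ _ _).2 ⟨T, 𝟙 _, y, z, inferInstance,
        by simpa [hP'] using hxy, by simpa [hQ'] using hyz, by simpa [hP'] using hzw⟩
    rw [h Q P hQ hP, relComp_relComp_factors_iff] at hx
    simpa only [hP', hQ'] using hx
  · intro h X R S hR hS
    have key : ∀ R S : Subobject (X ⨯ X), IsEquivRel R → IsEquivRel S →
        relComp S (relComp R S) ≤ relComp R (relComp S R) := by
      intro R S hR hS
      refine subobject_le_of_factors fun x w hx => ?_
      rw [relComp_relComp_factors_iff] at hx ⊢
      obtain ⟨T', e, y, z, he, h₁, h₂, h₃⟩ := hx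
      rw [factors_iff_related] at h₁ h₂ h₃
      obtain ⟨T'', e', y', z', he', h₁', h₂', h₃'⟩ := h _ _ _ _ hS hR _ _ _ _ h₁ h₂ h₃
      refine ⟨T'', e' ≫ e, y', z', isRegularEpi_comp _ _ he' he, ?_⟩
      simp only [factors_iff_related, Category.assoc]
      exact ⟨h₁', h₂', h₃'⟩
    exact le_antisymm (key R S hR hS) (key S R hS hR)

end Goursat

/-! ### Composition of generalized morphisms of an internal groupoid -/

namespace InternalGroupoid

section Comp

variable {C : Type u} [Category.{v} C] [HasPullbacks C] (A : InternalGroupoid C)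

/-- The composite `g ∘ f` of generalized elements of the object of morphisms. -/
noncomputable def comp {T : C} (g f : T ⟶ A.X₁) (h : g ≫ A.s = f ≫ A.t) : T ⟶ A.X₁ :=
  pullback.lift g f h ≫ A.m

variable {A} {T T' : C}

lemma comp_s (g f : T ⟶ A.X₁) (h : g ≫ A.s = f ≫ A.t) : A.comp g f h ≫ A.s = f ≫ A.s := by
  rw [comp, Category.assoc, A.m_s, pullback.lift_snd_assoc]

lemma comp_t (g f : T ⟶ A.X₁) (h : g ≫ A.s = f ≫ A.t) : A.comp g f h ≫ A.t = g ≫ A.t := by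
  rw [comp, Category.assoc, A.m_t, pullback.lift_fst_assoc]

lemma precomp_comp (e : T' ⟶ T) (g f : T ⟶ A.X₁) (h : g ≫ A.s = f ≫ A.t) :
    e ≫ A.comp g f h = A.comp (e ≫ g) (e ≫ f) (by simp [h]) := by
  rw [comp, comp, ← Category.assoc]
  congr 1
  apply pullback.hom_ext <;>
    simp only [Category.assoc, pullback.lift_fst, pullback.lift_snd]

lemma comp_congr {g g' f f' : T ⟶ A.X₁} (hg : g = g') (hf : f = f') (h : g ≫ A.s = f ≫ A.t) :
    A.comp g f h = A.comp g' f' (by rw [← hg, ← hf, h]) := by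
  subst hg hf
  rfl

lemma comp_unit (f x : T ⟶ A.X₁) (hx : x = f ≫ A.s ≫ A.u) (h : f ≫ A.s = x ≫ A.t) :
    A.comp f x h = f := by
  subst hx
  have := congr(f ≫ $(A.m_u)).trans (Category.comp_id f)
  refine Eq.trans ?_ ((Category.assoc _ _ _).trans this)
  rw [comp]
  congr 1
  apply pullback.hom_ext <;>
    simp only [Category.assoc, pullback.lift_fst, pullback.lift_snd, Category.comp_id]

lemma unit_comp (f x : T ⟶ A.X₁) (hx : x = f ≫ A.t ≫ A.u) (h : x ≫ A.s = f ≫ A.t) :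
    A.comp x f h = f := by
  subst hx
  have := congr(f ≫ $(A.u_m)).trans (Category.comp_id f)
  refine Eq.trans ?_ ((Category.assoc _ _ _).trans this)
  rw [comp]
  congr 1
  apply pullback.hom_ext <;>
    simp only [Category.assoc, pullback.lift_fst, pullback.lift_snd, Category.comp_id]

lemma comp_inv (f : T ⟶ A.X₁) (h : f ≫ A.s = (f ≫ A.i) ≫ A.t) :
    A.comp f (f ≫ A.i) h = f ≫ A.t ≫ A.u := by
  rw [← A.m_i, comp, ← Category.assoc]
  congr 1
  apply pullback.hom_ext <;>
    simp only [Category.assoc, pullback.lift_fst, pullback.lift_snd, Category.comp_id]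

lemma inv_comp (f : T ⟶ A.X₁) (h : (f ≫ A.i) ≫ A.s = f ≫ A.t) :
    A.comp (f ≫ A.i) f h = f ≫ A.s ≫ A.u := by
  rw [← A.i_m, comp, ← Category.assoc]
  congr 1
  apply pullback.hom_ext <;>
    simp only [Category.assoc, pullback.lift_fst, pullback.lift_snd, Category.comp_id]

lemma comp_assoc (h g f : T ⟶ A.X₁) (hg : h ≫ A.s = g ≫ A.t) (gf : g ≫ A.s = f ≫ A.t) :
    A.comp (A.comp h g hg) f (by rw [comp_s, gf]) =
      A.comp h (A.comp g f gf) (by rw [comp_t, hg]) :=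
  A.assoc h g f hg gf

/-- Left inverses are unique. -/
lemma eq_inv_of_comp_eq_unit (g f : T ⟶ A.X₁) (h : g ≫ A.s = f ≫ A.t)
    (hgf : A.comp g f h = f ≫ A.s ≫ A.u) : g = f ≫ A.i := by
  have h₁ : f ≫ A.s = (f ≫ A.i) ≫ A.t := by rw [Category.assoc, A.i_t]
  have h₂ := comp_assoc g f (f ≫ A.i) h h₁
  rw [comp_congr hgf rfl, unit_comp _ _ (by rw [Category.assoc, reassoc_of% A.i_t]),
    comp_congr rfl (comp_inv f h₁), comp_unit _ _ (by rw [reassoc_of% h])] at h₂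
  exact h₂.symm

variable (A) in
lemma i_i : A.i ≫ A.i = 𝟙 A.X₁ := by
  refine (eq_inv_of_comp_eq_unit (𝟙 A.X₁) A.i (by simp [A.i_t]) ?_).symm
  have := comp_inv (𝟙 A.X₁) (by simp [A.i_t])
  simp only [Category.id_comp] at this
  rw [this, reassoc_of% A.i_s]

/-- An internal groupoid given by a composition of generalized elements that is natural in the
domain. -/
noncomputable def ofComp {X₀ X₁ : C} (s t : X₁ ⟶ X₀) (u : X₀ ⟶ X₁) (i : X₁ ⟶ X₁)
    (c : ∀ {T : C} (g f : T ⟶ X₁), g ≫ s = f ≫ t → (T ⟶ X₁))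
    (c_nat : ∀ {T T' : C} (e : T' ⟶ T) (g f : T ⟶ X₁) h h', e ≫ c g f h = c (e ≫ g) (e ≫ f) h')
    (u_s : u ≫ s = 𝟙 X₀) (u_t : u ≫ t = 𝟙 X₀)
    (c_s : ∀ {T : C} (g f : T ⟶ X₁) h, c g f h ≫ s = f ≫ s)
    (c_t : ∀ {T : C} (g f : T ⟶ X₁) h, c g f h ≫ t = g ≫ t)
    (c_u : ∀ {T : C} (f : T ⟶ X₁) h, c f (f ≫ s ≫ u) h = f)
    (u_c : ∀ {T : C} (f : T ⟶ X₁) h, c (f ≫ t ≫ u) f h = f)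
    (assoc : ∀ {T : C} (h g f : T ⟶ X₁) (hg) (gf) (h₁) (h₂),
      c (c h g hg) f h₁ = c h (c g f gf) h₂)
    (i_s : i ≫ s = t) (i_t : i ≫ t = s)
    (c_i : ∀ {T : C} (f : T ⟶ X₁) h, c f (f ≫ i) h = f ≫ t ≫ u)
    (i_c : ∀ {T : C} (f : T ⟶ X₁) h, c (f ≫ i) f h = f ≫ s ≫ u) : InternalGroupoid C :=
  have key : ∀ {T : C} (g f : T ⟶ X₁) (h : g ≫ s = f ≫ t),
      pullback.lift g f h ≫ c (pullback.fst s t) (pullback.snd s t) pullback.condition =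
        c g f h := by
    intro T g f h
    rw [c_nat _ _ _ _ (by rw [pullback.lift_fst, pullback.lift_snd, h])]
    congr 1
    · exact pullback.lift_fst _ _ _
    · exact pullback.lift_snd _ _ _
  { X₀ := X₀
    X₁ := X₁
    s := s
    t := t
    u := u
    m := c (pullback.fst s t) (pullback.snd s t) pullback.condition
    i := i
    u_s := u_s
    u_t := u_t
    m_s := c_s _ _ _
    m_t := c_t _ _ _
    m_u := by
      rw [key]
      refine Eq.trans ?_ (c_u (𝟙 X₁) (by simp [u_t]))
      congr 1
      exact (Category.id_comp _).symm
    u_m := by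
      rw [key]
      refine Eq.trans ?_ (u_c (𝟙 X₁) (by simp [u_s]))
      congr 1
      exact (Category.id_comp _).symm
    assoc := by
      intro T h g f hg gf
      simp only [key]
      exact assoc h g f hg gf _ _
    i_s := i_s
    i_t := i_t
    m_i := by
      rw [key]
      refine Eq.trans ?_ ((c_i (𝟙 X₁) (by simp [i_t])).trans (Category.id_comp _))
      congr 1
      exact (Category.id_comp _).symm
    i_m := by
      rw [key]
      refine Eq.trans ?_ ((i_c (𝟙 X₁) (by simp [i_s])).trans (Category.id_comp _))
      congr 1
      exact (Category.id_comp _).symm }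

variable {B D : InternalGroupoid C}

@[ext]
lemma hom_ext {F G : A ⟶ B} (h₀ : F.f₀ = G.f₀) (h₁ : F.f₁ = G.f₁) : F = G :=
  Hom.ext h₀ h₁

lemma comp_map (F : A ⟶ B) (g f : T ⟶ A.X₁) (h : g ≫ A.s = f ≫ A.t) :
    A.comp g f h ≫ F.f₁ = B.comp (g ≫ F.f₁) (f ≫ F.f₁)
      (by rw [Category.assoc, Category.assoc, ← F.s_comm, ← F.t_comm, reassoc_of% h]) := by
  rw [comp, Category.assoc, F.m_comm, comp, ← Category.assoc]
  congr 1
  apply pullback.hom_ext <;>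
    simp only [pullback.map, Category.assoc, pullback.lift_fst, pullback.lift_snd,
      pullback.lift_fst_assoc, pullback.lift_snd_assoc]

lemma i_comm (F : A ⟶ B) : A.i ≫ F.f₁ = F.f₁ ≫ B.i := by
  have h := inv_comp (𝟙 A.X₁) (by simp [A.i_s])
  simp only [Category.id_comp] at h
  refine eq_inv_of_comp_eq_unit _ _
    (by rw [Category.assoc, ← F.s_comm, reassoc_of% A.i_s, F.t_comm]) ?_
  have := comp_map F A.i (𝟙 _) (by simp [A.i_s])
  rw [h, Category.assoc, F.u_comm, reassoc_of% F.s_comm] at this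
  rw [this]
  exact comp_congr rfl (Category.id_comp _).symm _

/-- An internal functor given by its effect on generalized elements. -/
def homMk (f₀ : A.X₀ ⟶ B.X₀) (f₁ : A.X₁ ⟶ B.X₁) (s_comm : A.s ≫ f₀ = f₁ ≫ B.s)
    (t_comm : A.t ≫ f₀ = f₁ ≫ B.t) (u_comm : A.u ≫ f₁ = f₀ ≫ B.u)
    (comp_comm : ∀ {T : C} (g f : T ⟶ A.X₁) h h',
      A.comp g f h ≫ f₁ = B.comp (g ≫ f₁) (f ≫ f₁) h') : A ⟶ B :=
  { f₀ := f₀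
    f₁ := f₁
    s_comm := s_comm
    t_comm := t_comm
    u_comm := u_comm
    m_comm := by
      have := comp_comm (pullback.fst A.s A.t) (pullback.snd A.s A.t) pullback.condition
        (by rw [Category.assoc, Category.assoc, ← s_comm, ← t_comm, pullback.condition_assoc])
      refine Eq.trans ?_ (this.trans ?_)
      · rw [comp, show pullback.lift _ _ _ = 𝟙 _ from ?_, Category.id_comp]
        apply pullback.hom_ext <;>
          simp only [pullback.lift_fst, pullback.lift_snd, Category.id_comp]
      · rfl }

end Comp

/-! ### Groupoids jointly embedded in two groupoids -/

section JointlyMono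

variable {C : Type u} [Category.{v} C] [HasPullbacks C]

/-- A reflexive graph with inversion, mapped jointly monically to two internal groupoids `A` and
`B`, whose arrows are closed under the compositions of `A` and `B`. Pullbacks, and subgroupoids
(with `A = B`), are of this form. -/
structure JointSubgroupoid (A B : InternalGroupoid C) where
  /-- the object of objects -/
  X₀ : C
  /-- the object of morphisms -/
  X₁ : C
  /-- source -/
  s : X₁ ⟶ X₀
  /-- target -/
  t : X₁ ⟶ X₀
  /-- identities -/
  u : X₀ ⟶ X₁
  /-- inversion -/
  i : X₁ ⟶ X₁
  /-- the map to the objects of `A` -/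
  a₀ : X₀ ⟶ A.X₀
  /-- the map to the morphisms of `A` -/
  a₁ : X₁ ⟶ A.X₁
  /-- the map to the objects of `B` -/
  b₀ : X₀ ⟶ B.X₀
  /-- the map to the morphisms of `B` -/
  b₁ : X₁ ⟶ B.X₁
  hom_ext₀ : ∀ {T : C} (f g : T ⟶ X₀), f ≫ a₀ = g ≫ a₀ → f ≫ b₀ = g ≫ b₀ → f = g
  hom_ext₁ : ∀ {T : C} (f g : T ⟶ X₁), f ≫ a₁ = g ≫ a₁ → f ≫ b₁ = g ≫ b₁ → f = g
  s_a : s ≫ a₀ = a₁ ≫ A.s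
  s_b : s ≫ b₀ = b₁ ≫ B.s
  t_a : t ≫ a₀ = a₁ ≫ A.t
  t_b : t ≫ b₀ = b₁ ≫ B.t
  u_a : u ≫ a₁ = a₀ ≫ A.u
  u_b : u ≫ b₁ = b₀ ≫ B.u
  i_a : i ≫ a₁ = a₁ ≫ A.i
  i_b : i ≫ b₁ = b₁ ≫ B.i
  exists_comp : ∀ {T : C} (g f : T ⟶ X₁) (_ : g ≫ s = f ≫ t)
    (h₁ : (g ≫ a₁) ≫ A.s = (f ≫ a₁) ≫ A.t) (h₂ : (g ≫ b₁) ≫ B.s = (f ≫ b₁) ≫ B.t),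
    ∃ k : T ⟶ X₁, k ≫ a₁ = A.comp (g ≫ a₁) (f ≫ a₁) h₁ ∧ k ≫ b₁ = B.comp (g ≫ b₁) (f ≫ b₁) h₂

namespace JointSubgroupoid

variable {A B : InternalGroupoid C} (P : JointSubgroupoid A B) {T : C}

lemma composable_a {g f : T ⟶ P.X₁} (h : g ≫ P.s = f ≫ P.t) :
    (g ≫ P.a₁) ≫ A.s = (f ≫ P.a₁) ≫ A.t := by
  rw [Category.assoc, Category.assoc, ← P.s_a, ← P.t_a, reassoc_of% h]

lemma composable_b {g f : T ⟶ P.X₁} (h : g ≫ P.s = f ≫ P.t) :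
    (g ≫ P.b₁) ≫ B.s = (f ≫ P.b₁) ≫ B.t := by
  rw [Category.assoc, Category.assoc, ← P.s_b, ← P.t_b, reassoc_of% h]

/-- The restricted composition. -/
noncomputable def compose (g f : T ⟶ P.X₁) (h : g ≫ P.s = f ≫ P.t) : T ⟶ P.X₁ :=
  (P.exists_comp g f h (P.composable_a h) (P.composable_b h)).choose

lemma compose_a (g f : T ⟶ P.X₁) (h : g ≫ P.s = f ≫ P.t) :
    P.compose g f h ≫ P.a₁ = A.comp (g ≫ P.a₁) (f ≫ P.a₁) (P.composable_a h) :=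
  (P.exists_comp g f h (P.composable_a h) (P.composable_b h)).choose_spec.1

lemma compose_b (g f : T ⟶ P.X₁) (h : g ≫ P.s = f ≫ P.t) :
    P.compose g f h ≫ P.b₁ = B.comp (g ≫ P.b₁) (f ≫ P.b₁) (P.composable_b h) :=
  (P.exists_comp g f h (P.composable_a h) (P.composable_b h)).choose_spec.2

/-- The internal groupoid with the composition inherited from `A` and `B`. -/
noncomputable def toGroupoid : InternalGroupoid C :=
  ofComp P.s P.t P.u P.i P.compose
    (c_nat := fun e g f h h' => by
      refine P.hom_ext₁ _ _ ?_ ?_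
      · simp only [Category.assoc, compose_a, precomp_comp]
      · simp only [Category.assoc, compose_b, precomp_comp])
    (u_s := by
      refine P.hom_ext₀ _ _ ?_ ?_
      · simp [P.s_a, reassoc_of% P.u_a, A.u_s]
      · simp [P.s_b, reassoc_of% P.u_b, B.u_s])
    (u_t := by
      refine P.hom_ext₀ _ _ ?_ ?_
      · simp [P.t_a, reassoc_of% P.u_a, A.u_t]
      · simp [P.t_b, reassoc_of% P.u_b, B.u_t])
    (c_s := fun g f h => by
      refine P.hom_ext₀ _ _ ?_ ?_
      · rw [Category.assoc, Category.assoc, P.s_a, reassoc_of% P.compose_a, comp_s, Category.assoc]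
      · rw [Category.assoc, Category.assoc, P.s_b, reassoc_of% P.compose_b, comp_s, Category.assoc])
    (c_t := fun g f h => by
      refine P.hom_ext₀ _ _ ?_ ?_
      · rw [Category.assoc, Category.assoc, P.t_a, reassoc_of% P.compose_a, comp_t, Category.assoc]
      · rw [Category.assoc, Category.assoc, P.t_b, reassoc_of% P.compose_b, comp_t, Category.assoc])
    (c_u := fun f h => by
      refine P.hom_ext₁ _ _ ?_ ?_
      · rw [compose_a, comp_unit]
        simp only [Category.assoc, P.u_a, reassoc_of% P.s_a]
      · rw [compose_b, comp_unit]
        simp only [Category.assoc, P.u_b, reassoc_of% P.s_b])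
    (u_c := fun f h => by
      refine P.hom_ext₁ _ _ ?_ ?_
      · rw [compose_a, unit_comp]
        simp only [Category.assoc, P.u_a, reassoc_of% P.t_a]
      · rw [compose_b, unit_comp]
        simp only [Category.assoc, P.u_b, reassoc_of% P.t_b])
    (assoc := fun h g f hg gf h₁ h₂ => by
      refine P.hom_ext₁ _ _ ?_ ?_
      · refine (P.compose_a _ _ _).trans (.trans ?_ (P.compose_a _ _ _).symm)
        exact (comp_congr (P.compose_a _ _ _) rfl _).trans
          ((comp_assoc _ _ _ (P.composable_a hg) (P.composable_a gf)).trans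
            (comp_congr rfl (P.compose_a _ _ _) _).symm)
      · refine (P.compose_b _ _ _).trans (.trans ?_ (P.compose_b _ _ _).symm)
        exact (comp_congr (P.compose_b _ _ _) rfl _).trans
          ((comp_assoc _ _ _ (P.composable_b hg) (P.composable_b gf)).trans
            (comp_congr rfl (P.compose_b _ _ _) _).symm))
    (i_s := by
      refine P.hom_ext₀ _ _ ?_ ?_
      · rw [Category.assoc, P.s_a, reassoc_of% P.i_a, A.i_s, P.t_a]
      · rw [Category.assoc, P.s_b, reassoc_of% P.i_b, B.i_s, P.t_b])
    (i_t := by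
      refine P.hom_ext₀ _ _ ?_ ?_
      · rw [Category.assoc, P.t_a, reassoc_of% P.i_a, A.i_t, P.s_a]
      · rw [Category.assoc, P.t_b, reassoc_of% P.i_b, B.i_t, P.s_b])
    (c_i := fun f h => by
      have ha : (f ≫ P.i) ≫ P.a₁ = (f ≫ P.a₁) ≫ A.i := by simp [P.i_a]
      have hb : (f ≫ P.i) ≫ P.b₁ = (f ≫ P.b₁) ≫ B.i := by simp [P.i_b]
      refine P.hom_ext₁ _ _ ?_ ?_
      · rw [compose_a, comp_congr rfl ha, comp_inv]
        simp only [Category.assoc, P.u_a, reassoc_of% P.t_a]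
      · rw [compose_b, comp_congr rfl hb, comp_inv]
        simp only [Category.assoc, P.u_b, reassoc_of% P.t_b])
    (i_c := fun f h => by
      have ha : (f ≫ P.i) ≫ P.a₁ = (f ≫ P.a₁) ≫ A.i := by simp [P.i_a]
      have hb : (f ≫ P.i) ≫ P.b₁ = (f ≫ P.b₁) ≫ B.i := by simp [P.i_b]
      refine P.hom_ext₁ _ _ ?_ ?_
      · rw [compose_a, comp_congr ha rfl, inv_comp]
        simp only [Category.assoc, P.u_a, reassoc_of% P.s_a]
      · rw [compose_b, comp_congr hb rfl, inv_comp]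
        simp only [Category.assoc, P.u_b, reassoc_of% P.s_b])

lemma toGroupoid_comp (g f : T ⟶ P.X₁) (h : g ≫ P.s = f ≫ P.t) :
    P.toGroupoid.comp g f h = P.compose g f h := by
  refine P.hom_ext₁ _ _ ?_ ?_
  · have := P.compose_a (pullback.fst P.s P.t) (pullback.snd P.s P.t) pullback.condition
    refine (Category.assoc _ _ _).trans ((congr(pullback.lift g f h ≫ $this)).trans ?_)
    rw [precomp_comp, compose_a]
    refine comp_congr ?_ ?_ _
    · rw [pullback.lift_fst_assoc]
    · rw [pullback.lift_snd_assoc]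
  · have := P.compose_b (pullback.fst P.s P.t) (pullback.snd P.s P.t) pullback.condition
    refine (Category.assoc _ _ _).trans ((congr(pullback.lift g f h ≫ $this)).trans ?_)
    rw [precomp_comp, compose_b]
    refine comp_congr ?_ ?_ _
    · rw [pullback.lift_fst_assoc]
    · rw [pullback.lift_snd_assoc]

/-- The internal functor to `A`. -/
noncomputable def homA : P.toGroupoid ⟶ A :=
  homMk (A := P.toGroupoid) P.a₀ P.a₁ P.s_a P.t_a P.u_a fun g f h _ =>
    (congr($(P.toGroupoid_comp g f h) ≫ P.a₁)).trans (P.compose_a g f h)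

/-- The internal functor to `B`. -/
noncomputable def homB : P.toGroupoid ⟶ B :=
  homMk (A := P.toGroupoid) P.b₀ P.b₁ P.s_b P.t_b P.u_b fun g f h _ =>
    (congr($(P.toGroupoid_comp g f h) ≫ P.b₁)).trans (P.compose_b g f h)

variable {P} in
lemma hom_ext {D : InternalGroupoid C} {F G : D ⟶ P.toGroupoid} (ha : F ≫ P.homA = G ≫ P.homA)
    (hb : F ≫ P.homB = G ≫ P.homB) : F = G :=
  InternalGroupoid.hom_ext (P.hom_ext₀ _ _ congr($(ha).f₀) congr($(hb).f₀))
    (P.hom_ext₁ _ _ congr($(ha).f₁) congr($(hb).f₁))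

/-- A pair of internal functors to `A` and `B` whose components factor through `P`. -/
noncomputable def lift {D : InternalGroupoid C} (F : D ⟶ A) (G : D ⟶ B) (k₀ : D.X₀ ⟶ P.X₀)
    (k₁ : D.X₁ ⟶ P.X₁) (h₀ : k₀ ≫ P.a₀ = F.f₀) (h₁ : k₁ ≫ P.a₁ = F.f₁)
    (h₀' : k₀ ≫ P.b₀ = G.f₀) (h₁' : k₁ ≫ P.b₁ = G.f₁) : D ⟶ P.toGroupoid :=
  have hs : D.s ≫ k₀ = k₁ ≫ P.s := by
    refine P.hom_ext₀ _ _ ?_ ?_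
    · rw [Category.assoc, Category.assoc, h₀, P.s_a, reassoc_of% h₁, F.s_comm]
    · rw [Category.assoc, Category.assoc, h₀', P.s_b, reassoc_of% h₁', G.s_comm]
  have ht : D.t ≫ k₀ = k₁ ≫ P.t := by
    refine P.hom_ext₀ _ _ ?_ ?_
    · rw [Category.assoc, Category.assoc, h₀, P.t_a, reassoc_of% h₁, F.t_comm]
    · rw [Category.assoc, Category.assoc, h₀', P.t_b, reassoc_of% h₁', G.t_comm]
  have hu : D.u ≫ k₁ = k₀ ≫ P.u := by
    refine P.hom_ext₁ _ _ ?_ ?_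
    · rw [Category.assoc, Category.assoc, h₁, P.u_a, reassoc_of% h₀, F.u_comm]
    · rw [Category.assoc, Category.assoc, h₁', P.u_b, reassoc_of% h₀', G.u_comm]
  have hc : ∀ {T : C} (g f : T ⟶ D.X₁) (h : g ≫ D.s = f ≫ D.t)
      (h' : (g ≫ k₁) ≫ P.s = (f ≫ k₁) ≫ P.t),
      D.comp g f h ≫ k₁ = P.compose (g ≫ k₁) (f ≫ k₁) h' := by
    intro T g f h h'
    refine P.hom_ext₁ _ _ ?_ ?_
    · rw [Category.assoc, h₁, comp_map, compose_a]
      exact comp_congr (by rw [Category.assoc, h₁]) (by rw [Category.assoc, h₁]) _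
    · rw [Category.assoc, h₁', comp_map, compose_b]
      exact comp_congr (by rw [Category.assoc, h₁']) (by rw [Category.assoc, h₁']) _
  homMk (B := P.toGroupoid) k₀ k₁ hs ht hu fun g f h h' =>
    (hc g f h h').trans (P.toGroupoid_comp _ _ h').symm

end JointSubgroupoid

end JointlyMono

/-! ### Finite limits of internal groupoids -/

section Limits

variable {C : Type u} [Category.{v} C]

section Pullbacks

variable [HasPullbacks C] {A B D : InternalGroupoid C} (F : A ⟶ D) (G : B ⟶ D)

/-- The componentwise pullback of two internal functors. -/
noncomputable def pullbackSubgroupoid : JointSubgroupoid A B where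
  X₀ := pullback F.f₀ G.f₀
  X₁ := pullback F.f₁ G.f₁
  s := pullback.lift (pullback.fst _ _ ≫ A.s) (pullback.snd _ _ ≫ B.s) (by
    simp only [Category.assoc, F.s_comm, G.s_comm, pullback.condition_assoc])
  t := pullback.lift (pullback.fst _ _ ≫ A.t) (pullback.snd _ _ ≫ B.t) (by
    simp only [Category.assoc, F.t_comm, G.t_comm, pullback.condition_assoc])
  u := pullback.lift (pullback.fst _ _ ≫ A.u) (pullback.snd _ _ ≫ B.u) (by
    simp only [Category.assoc, F.u_comm, G.u_comm, pullback.condition_assoc])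
  i := pullback.lift (pullback.fst _ _ ≫ A.i) (pullback.snd _ _ ≫ B.i) (by
    simp only [Category.assoc, i_comm, pullback.condition_assoc])
  a₀ := pullback.fst _ _
  a₁ := pullback.fst _ _
  b₀ := pullback.snd _ _
  b₁ := pullback.snd _ _
  hom_ext₀ _ _ h h' := pullback.hom_ext h h'
  hom_ext₁ _ _ h h' := pullback.hom_ext h h'
  s_a := pullback.lift_fst _ _ _
  s_b := pullback.lift_snd _ _ _
  t_a := pullback.lift_fst _ _ _
  t_b := pullback.lift_snd _ _ _
  u_a := pullback.lift_fst _ _ _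
  u_b := pullback.lift_snd _ _ _
  i_a := pullback.lift_fst _ _ _
  i_b := pullback.lift_snd _ _ _
  exists_comp g f _ h₁ h₂ :=
    ⟨pullback.lift (A.comp _ _ h₁) (B.comp _ _ h₂) (by
      rw [comp_map, comp_map]
      exact comp_congr (by simp only [Category.assoc, pullback.condition])
        (by simp only [Category.assoc, pullback.condition]) _),
      pullback.lift_fst _ _ _, pullback.lift_snd _ _ _⟩

lemma pullbackSubgroupoid_condition : (pullbackSubgroupoid F G).homA ≫ F =
    (pullbackSubgroupoid F G).homB ≫ G :=
  hom_ext pullback.condition pullback.condition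

/-- The universal property of the componentwise pullback. -/
noncomputable def pullbackSubgroupoidIsLimit :
    IsLimit (PullbackCone.mk _ _ (pullbackSubgroupoid_condition F G)) :=
  PullbackCone.IsLimit.mk _
    (fun s => JointSubgroupoid.lift _ s.fst s.snd
      (pullback.lift s.fst.f₀ s.snd.f₀ congr($(s.condition).f₀))
      (pullback.lift s.fst.f₁ s.snd.f₁ congr($(s.condition).f₁))
      (pullback.lift_fst _ _ _) (pullback.lift_fst _ _ _)
      (pullback.lift_snd _ _ _) (pullback.lift_snd _ _ _))
    (fun _ => hom_ext (pullback.lift_fst _ _ _) (pullback.lift_fst _ _ _))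
    (fun _ => hom_ext (pullback.lift_snd _ _ _) (pullback.lift_snd _ _ _))
    (fun _ _ h h' => JointSubgroupoid.hom_ext
      (h.trans (hom_ext (pullback.lift_fst _ _ _) (pullback.lift_fst _ _ _)).symm)
      (h'.trans (hom_ext (pullback.lift_snd _ _ _) (pullback.lift_snd _ _ _)).symm))

instance : HasPullbacks (InternalGroupoid C) :=
  have : ∀ {A B D : InternalGroupoid C} {F : A ⟶ D} {G : B ⟶ D}, HasLimit (cospan F G) :=
    ⟨⟨_, pullbackSubgroupoidIsLimit _ _⟩⟩
  hasPullbacks_of_hasLimit_cospan _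

variable (C) in
/-- The functor taking an internal groupoid to its object of objects. -/
def ob : InternalGroupoid C ⥤ C where
  obj A := A.X₀
  map F := F.f₀

variable (C) in
/-- The functor taking an internal groupoid to its object of morphisms. -/
def mor : InternalGroupoid C ⥤ C where
  obj A := A.X₁
  map F := F.f₁

instance : PreservesLimitsOfShape WalkingCospan (ob C) where
  preservesLimit {K} := by
    have (F : K.obj .left ⟶ K.obj .one) (G : K.obj .right ⟶ K.obj .one) :
        PreservesLimit (cospan F G) (ob C) :=
      preservesLimit_of_preserves_limit_cone (pullbackSubgroupoidIsLimit F G)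
        ((isLimitMapConePullbackConeEquiv _ _).symm (pullbackIsPullback F.f₀ G.f₀))
    exact preservesLimit_of_iso_diagram _ (diagramIsoCospan K).symm

instance : PreservesLimitsOfShape WalkingCospan (mor C) where
  preservesLimit {K} := by
    have (F : K.obj .left ⟶ K.obj .one) (G : K.obj .right ⟶ K.obj .one) :
        PreservesLimit (cospan F G) (mor C) :=
      preservesLimit_of_preserves_limit_cone (pullbackSubgroupoidIsLimit F G)
        ((isLimitMapConePullbackConeEquiv _ _).symm (pullbackIsPullback F.f₁ G.f₁))
    exact preservesLimit_of_iso_diagram _ (diagramIsoCospan K).symm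

end Pullbacks

variable [HasFiniteLimits C]

variable (C) in
/-- The terminal internal groupoid. -/
noncomputable def terminalGroupoid : InternalGroupoid C where
  X₀ := ⊤_ C
  X₁ := ⊤_ C
  s := 𝟙 _
  t := 𝟙 _
  u := 𝟙 _
  m := terminal.from _
  i := 𝟙 _
  u_s := Subsingleton.elim _ _
  u_t := Subsingleton.elim _ _
  m_s := Subsingleton.elim _ _
  m_t := Subsingleton.elim _ _
  m_u := Subsingleton.elim _ _
  u_m := Subsingleton.elim _ _
  assoc _ _ _ _ _ := Subsingleton.elim _ _
  i_s := Subsingleton.elim _ _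
  i_t := Subsingleton.elim _ _
  m_i := Subsingleton.elim _ _
  i_m := Subsingleton.elim _ _

variable (C) in
/-- The universal property of the terminal internal groupoid. -/
noncomputable def terminalGroupoidIsTerminal : IsTerminal (terminalGroupoid C) :=
  IsTerminal.ofUniqueHom
    (fun _ =>
      { f₀ := terminal.from _
        f₁ := terminal.from _
        s_comm := terminal.hom_ext _ _
        t_comm := terminal.hom_ext _ _
        u_comm := terminal.hom_ext _ _
        m_comm := terminal.hom_ext _ _ })
    (fun _ _ => hom_ext (terminal.hom_ext _ _) (terminal.hom_ext _ _))

instance : HasFiniteLimits (InternalGroupoid C) :=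
  have := (terminalGroupoidIsTerminal C).hasTerminal
  hasFiniteLimits_of_hasTerminal_and_pullbacks

instance : PreservesFiniteLimits (ob C) :=
  have : PreservesLimit (Functor.empty.{0} (InternalGroupoid C)) (ob C) :=
    preservesLimit_of_preserves_limit_cone (terminalGroupoidIsTerminal C)
      ((isLimitMapConeEmptyConeEquiv _ _).symm terminalIsTerminal)
  have := preservesLimitsOfShape_pempty_of_preservesTerminal (ob C)
  preservesFiniteLimits_of_preservesTerminal_and_pullbacks (ob C)

instance : PreservesFiniteLimits (mor C) :=
  have : PreservesLimit (Functor.empty.{0} (InternalGroupoid C)) (mor C) :=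
    preservesLimit_of_preserves_limit_cone (terminalGroupoidIsTerminal C)
      ((isLimitMapConeEmptyConeEquiv _ _).symm terminalIsTerminal)
  have := preservesLimitsOfShape_pempty_of_preservesTerminal (mor C)
  preservesFiniteLimits_of_preservesTerminal_and_pullbacks (mor C)

end Limits

/-! ### Codiscrete internal groupoids -/

section Codiscrete

variable {C : Type u} [Category.{v} C] [HasFiniteLimits C]

/-- The codiscrete groupoid on `X`, with a unique morphism between any two elements of `X`: its
object of morphisms is `X ⨯ X`, with source `prod.fst` and target `prod.snd`. -/
noncomputable def codisc (X : C) : InternalGroupoid C :=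
  ofComp (X₀ := X) (X₁ := X ⨯ X) prod.fst prod.snd (prod.lift (𝟙 _) (𝟙 _))
    (prod.lift prod.snd prod.fst) (fun g f _ => prod.lift (f ≫ prod.fst) (g ≫ prod.snd))
    (c_nat := by intros; apply prod.hom_ext <;> simp [prod.lift_fst, prod.lift_snd])
    (u_s := prod.lift_fst _ _)
    (u_t := prod.lift_snd _ _)
    (c_s := fun _ _ _ => prod.lift_fst _ _)
    (c_t := fun _ _ _ => prod.lift_snd _ _)
    (c_u := by intros; apply prod.hom_ext <;> simp [prod.lift_fst, prod.lift_snd])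
    (u_c := by intros; apply prod.hom_ext <;> simp [prod.lift_fst, prod.lift_snd])
    (assoc := by intros; apply prod.hom_ext <;> simp [prod.lift_fst, prod.lift_snd])
    (i_s := prod.lift_fst _ _)
    (i_t := prod.lift_snd _ _)
    (c_i := by intros; apply prod.hom_ext <;> simp [prod.lift_fst, prod.lift_snd])
    (i_c := by intros; apply prod.hom_ext <;> simp [prod.lift_fst, prod.lift_snd])

lemma codisc_hom_ext {X T : C} {f g : T ⟶ (codisc X).X₁}
    (hs : f ≫ (codisc X).s = g ≫ (codisc X).s) (ht : f ≫ (codisc X).t = g ≫ (codisc X).t) :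
    f = g :=
  prod.hom_ext hs ht

lemma exists_codisc_hom {X T : C} (x y : T ⟶ (codisc X).X₀) :
    ∃ k : T ⟶ (codisc X).X₁, k ≫ (codisc X).s = x ∧ k ≫ (codisc X).t = y :=
  ⟨prod.lift x y, prod.lift_fst _ _, prod.lift_snd _ _⟩

/-- The internal functor to a codiscrete groupoid with object part `k`. -/
noncomputable def toCodisc {A : InternalGroupoid C} {X : C} (k : A.X₀ ⟶ (codisc X).X₀) :
    A ⟶ codisc X :=
  have h := exists_codisc_hom (A.s ≫ k) (A.t ≫ k)
  have hs := h.choose_spec.1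
  have ht := h.choose_spec.2
  homMk (A := A) (B := codisc X) k h.choose hs.symm ht.symm
    (codisc_hom_ext
      (by
        rw [Category.assoc, hs, Category.assoc, reassoc_of% A.u_s, (codisc X).u_s,
          Category.comp_id])
      (by
        rw [Category.assoc, ht, Category.assoc, reassoc_of% A.u_t, (codisc X).u_t,
          Category.comp_id]))
    (fun g f h h' => codisc_hom_ext
      (by rw [Category.assoc, hs, reassoc_of% comp_s, comp_s, Category.assoc, hs])
      (by rw [Category.assoc, ht, reassoc_of% comp_t, comp_t, Category.assoc, ht]))

lemma toCodisc_ext {A : InternalGroupoid C} {X : C} {F G : A ⟶ codisc X} (h : F.f₀ = G.f₀) :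
    F = G := by
  refine hom_ext h (codisc_hom_ext ?_ ?_)
  · rw [← F.s_comm, ← G.s_comm, h]
  · rw [← F.t_comm, ← G.t_comm, h]

variable (C) in
/-- The functor sending an object to its codiscrete groupoid. -/
noncomputable def codiscFunctor : C ⥤ InternalGroupoid C where
  obj X := codisc X
  map f := toCodisc (A := codisc _) f
  map_id _ := toCodisc_ext rfl
  map_comp _ _ := toCodisc_ext rfl

/-- The object-of-objects functor is left adjoint to the codiscrete groupoid functor. -/
noncomputable def obAdjunction : ob C ⊣ codiscFunctor C :=
  Adjunction.mkOfHomEquiv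
    { homEquiv := fun _ _ =>
        { toFun := fun k => toCodisc k
          invFun := fun F => F.f₀
          left_inv := fun _ => rfl
          right_inv := fun _ => toCodisc_ext rfl }
      homEquiv_naturality_left_symm := fun _ _ => rfl
      homEquiv_naturality_right := fun _ _ => toCodisc_ext rfl }

end Codiscrete

end InternalGroupoid

/-! ### Functors preserving finite limits -/

section Functor

variable {C : Type*} {D : Type*} [Category* C] [Category* D] (F : C ⥤ D)

lemma Related.map {R X Y T : C} {p : R ⟶ X} {q : R ⟶ Y} {x : T ⟶ X} {y : T ⟶ Y}
    (h : Related p q x y) : Related (F.map p) (F.map q) (F.map x) (F.map y) := by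
  obtain ⟨r, rfl, rfl⟩ := h
  exact ⟨F.map r, by simp, by simp⟩

variable [HasFiniteLimits C] [PreservesFiniteLimits F]

lemma map_prod_hom_ext {X Y : C} {T : D} {f g : T ⟶ F.obj (X ⨯ Y)}
    (h₁ : f ≫ F.map prod.fst = g ≫ F.map prod.fst)
    (h₂ : f ≫ F.map prod.snd = g ≫ F.map prod.snd) : f = g :=
  BinaryFan.IsLimit.hom_ext (isLimitOfHasBinaryProductOfPreservesLimit F X Y) h₁ h₂

lemma CategoryTheory.IsEquivalenceRelation.map {R X : C} {p q : R ⟶ X}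
    (h : IsEquivalenceRelation p q) : IsEquivalenceRelation (F.map p) (F.map q) := by
  have := h.mono_prod_lift
  obtain ⟨⟨e⟩⟩ := h
  have hF : JointlyMono₂ (F.map p) (F.map q) := ⟨fun T f g h₁ h₂ => by
    rw [← cancel_mono (F.map (prod.lift p q))]
    refine map_prod_hom_ext F ?_ ?_
    · simpa only [Category.assoc, ← F.map_comp, prod.lift_fst] using h₁
    · simpa only [Category.assoc, ← F.map_comp, prod.lift_snd] using h₂⟩
  exact ⟨⟨{ e.toReflexiveRelation.map F, e.toSymmetricRelation.map F,
    e.toTransitiveRelation.map F with }⟩⟩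

end Functor

/-! ### Lifting along quotients in Goursat categories -/

section Goursat

variable {C : Type u} [Category.{v} C] [Regular C]

/-- In a Goursat category, a morphism of split epimorphisms `(e₁, e₀)` from `s` to `s'` induces a
map between kernel pairs whose image contains every pair `(x ≫ e₁, y ≫ e₁)` on which `s'` agrees.
With `S` the kernel pair of `s`, `R` that of `e₁` and `u` the section of `s`, one has the chain
`x S (s x) u R (s y) u S y`, and permuting it gives the elements looked for. -/
lemma IsGoursat.exists_kernelPair_lift (hC : IsGoursat C) {A₀ A₁ I₀ I₁ T : C} {s : A₁ ⟶ A₀}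
    {u : A₀ ⟶ A₁} {s' : I₁ ⟶ I₀} {u' : I₀ ⟶ I₁} {e₀ : A₀ ⟶ I₀} {e₁ : A₁ ⟶ I₁}
    (us : u ≫ s = 𝟙 A₀) (hs : s ≫ e₀ = e₁ ≫ s') (hu : u ≫ e₁ = e₀ ≫ u') (x y : T ⟶ A₁)
    (h : x ≫ e₁ ≫ s' = y ≫ e₁ ≫ s') :
    ∃ (T' : C) (e : T' ⟶ T) (x' y' : T' ⟶ A₁), IsRegularEpi e ∧ x' ≫ e₁ = e ≫ x ≫ e₁ ∧
      y' ≫ e₁ = e ≫ y ≫ e₁ ∧ x' ≫ s = y' ≫ s := by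
  obtain ⟨T', e, x', y', he, h₁, h₂, h₃⟩ := isGoursat_iff.1 hC _ _ _ _
    (isEquivalenceRelation_pullback s) (isEquivalenceRelation_pullback e₁) x (x ≫ s ≫ u)
    (y ≫ s ≫ u) y
    ((related_pullback_iff _ _ _).2 (by simp [us]))
    ((related_pullback_iff _ _ _).2 (by
      simp only [Category.assoc, hu, reassoc_of% hs, reassoc_of% h]))
    ((related_pullback_iff _ _ _).2 (by simp [us]))
  rw [related_pullback_iff] at h₁ h₂ h₃
  exact ⟨T', e, x', y', he, by simpa using h₁.symm, by simpa using h₃, h₂⟩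

variable {A B : InternalGroupoid C}

/-- In a Goursat category, if a groupoid `A` maps onto a reflexive graph `I` with inversion, then
composable pairs of `I` lift to composable pairs of `A`: apply `exists_kernelPair_lift` to the pair
`(g, f⁻¹)`, whose members have the same source. -/
lemma IsGoursat.exists_composable_lift (hC : IsGoursat C) {I₀ I₁ T : C} {s t : I₁ ⟶ I₀}
    {u : I₀ ⟶ I₁} {i : I₁ ⟶ I₁} (i_s : i ≫ s = t) (i_i : i ≫ i = 𝟙 I₁) {e₀ : A.X₀ ⟶ I₀}
    {e₁ : A.X₁ ⟶ I₁} (he₁ : IsRegularEpi e₁) (hs : A.s ≫ e₀ = e₁ ≫ s) (hu : A.u ≫ e₁ = e₀ ≫ u)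
    (hi : A.i ≫ e₁ = e₁ ≫ i) (g f : T ⟶ I₁) (h : g ≫ s = f ≫ t) :
    ∃ (T' : C) (e : T' ⟶ T) (a b : T' ⟶ A.X₁), IsRegularEpi e ∧ a ≫ e₁ = e ≫ g ∧
      b ≫ e₁ = e ≫ f ∧ a ≫ A.s = b ≫ A.t := by
  obtain ⟨T₁, c₁, x, hc₁, hx⟩ := exists_cover_lift he₁ g
  obtain ⟨T₂, c₂, y, hc₂, hy⟩ := exists_cover_lift he₁ (c₁ ≫ f ≫ i)
  obtain ⟨T₃, c₃, x', y', hc₃, hx', hy', h'⟩ := hC.exists_kernelPair_lift A.u_s hs hu (c₂ ≫ x) y (by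
    rw [Category.assoc, reassoc_of% hx, reassoc_of% hy, i_s, h])
  refine ⟨T₃, c₃ ≫ c₂ ≫ c₁, x', y' ≫ A.i,
    isRegularEpi_comp _ _ hc₃ (isRegularEpi_comp _ _ hc₂ hc₁), ?_, ?_, ?_⟩
  · rw [hx', Category.assoc, hx, Category.assoc, Category.assoc]
  · rw [Category.assoc, hi, reassoc_of% hy', reassoc_of% hy, i_i, Category.comp_id,
      Category.assoc, Category.assoc]
  · rw [h', Category.assoc, A.i_t]

namespace InternalGroupoid

/-! ### Regularity of the category of internal groupoids of a Goursat category -/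

/-- The image of an internal functor, computed componentwise, is an internal groupoid. -/
lemma exists_image_fac (hC : IsGoursat C) (F : A ⟶ B) :
    ∃ (I : InternalGroupoid C) (E : A ⟶ I) (N : I ⟶ B), IsRegularEpi E.f₀ ∧ IsRegularEpi E.f₁ ∧
      Mono N ∧ E ≫ N = F := by
  obtain ⟨I₀, e₀, n₀, he₀, hn₀, fac₀⟩ := exists_regularEpi_mono_fac F.f₀
  obtain ⟨I₁, e₁, n₁, he₁, hn₁, fac₁⟩ := exists_regularEpi_mono_fac F.f₁
  obtain ⟨s, hs, hs'⟩ := exists_diagonal_of_regularEpi_mono he₁ (A.s ≫ e₀) (n₁ ≫ B.s)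
    (by rw [Category.assoc, fac₀, F.s_comm, ← fac₁, Category.assoc])
  obtain ⟨t, ht, ht'⟩ := exists_diagonal_of_regularEpi_mono he₁ (A.t ≫ e₀) (n₁ ≫ B.t)
    (by rw [Category.assoc, fac₀, F.t_comm, ← fac₁, Category.assoc])
  obtain ⟨u, hu, hu'⟩ := exists_diagonal_of_regularEpi_mono he₀ (A.u ≫ e₁) (n₀ ≫ B.u)
    (by rw [Category.assoc, fac₁, F.u_comm, ← fac₀, Category.assoc])
  obtain ⟨i, hi, hi'⟩ := exists_diagonal_of_regularEpi_mono he₁ (A.i ≫ e₁) (n₁ ≫ B.i)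
    (by rw [Category.assoc, fac₁, i_comm, ← fac₁, Category.assoc])
  have i_s : i ≫ s = t := by
    rw [← cancel_mono n₀, Category.assoc, hs', reassoc_of% hi', B.i_s, ht']
  have i_i : i ≫ i = 𝟙 I₁ := by
    rw [← cancel_mono n₁, Category.assoc, hi', reassoc_of% hi', B.i_i, Category.comp_id,
      Category.id_comp]
  have hcomp : ∀ {T : C} (g f : T ⟶ I₁) (_ : g ≫ s = f ≫ t)
      (h' : (g ≫ n₁) ≫ B.s = (f ≫ n₁) ≫ B.t),
      ∃ k : T ⟶ I₁, k ≫ n₁ = B.comp (g ≫ n₁) (f ≫ n₁) h' := by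
    intro T g f h h'
    -- over a cover, the composite is the image of a composite in `A`
    obtain ⟨T', e, a, b, he, ha, hb, hab⟩ :=
      hC.exists_composable_lift i_s i_i he₁ hs.symm hu.symm hi.symm g f h
    obtain ⟨k, -, hk⟩ := exists_diagonal_of_regularEpi_mono (n := n₁) he (A.comp a b hab ≫ e₁)
      (B.comp (g ≫ n₁) (f ≫ n₁) h') (by
        rw [Category.assoc, fac₁, comp_map, precomp_comp]
        refine comp_congr ?_ ?_ _
        · rw [← fac₁, reassoc_of% ha]
        · rw [← fac₁, reassoc_of% hb])
    exact ⟨k, hk⟩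
  let I : JointSubgroupoid B B :=
    { X₀ := I₀
      X₁ := I₁
      s := s
      t := t
      u := u
      i := i
      a₀ := n₀
      a₁ := n₁
      b₀ := n₀
      b₁ := n₁
      hom_ext₀ := fun f g h _ => (cancel_mono n₀).1 h
      hom_ext₁ := fun f g h _ => (cancel_mono n₁).1 h
      s_a := hs'
      s_b := hs'
      t_a := ht'
      t_b := ht'
      u_a := hu'
      u_b := hu'
      i_a := hi'
      i_b := hi'
      exists_comp := fun g f h h₁ _ => (hcomp g f h h₁).imp fun _ hk => ⟨hk, hk⟩ }
  exact ⟨I.toGroupoid, JointSubgroupoid.lift I F F e₀ e₁ fac₀ fac₁ fac₀ fac₁, I.homA, he₀, he₁,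
    ⟨fun _ _ h => JointSubgroupoid.hom_ext h h⟩, hom_ext fac₀ fac₁⟩

lemma isRegularEpi_of_components (hC : IsGoursat C) (F : A ⟶ B) (h₀ : IsRegularEpi F.f₀)
    (h₁ : IsRegularEpi F.f₁) : IsRegularEpi F := by
  have : Epi F := ⟨fun G H h => hom_ext ((cancel_epi F.f₀).1 congr($(h).f₀))
    ((cancel_epi F.f₁).1 congr($(h).f₁))⟩
  refine IsRegularEpi.of_epi_of_exists fun D G hG => ?_
  have hG' : (pullbackSubgroupoid F F).homA ≫ G = (pullbackSubgroupoid F F).homB ≫ G := by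
    rw [← pullback.lift_fst _ _ (pullbackSubgroupoid_condition F F), Category.assoc, hG,
      pullback.lift_snd_assoc]
  obtain ⟨l₀, hl₀⟩ := exists_desc_of_regularEpi h₀ G.f₀ congr($(hG').f₀)
  obtain ⟨l₁, hl₁⟩ := exists_desc_of_regularEpi h₁ G.f₁ congr($(hG').f₁)
  refine ⟨homMk l₀ l₁ ?_ ?_ ?_ fun g f h h' => ?_, hom_ext hl₀ hl₁⟩
  · rw [← cancel_epi F.f₁, ← reassoc_of% F.s_comm, hl₀, G.s_comm, reassoc_of% hl₁]
  · rw [← cancel_epi F.f₁, ← reassoc_of% F.t_comm, hl₀, G.t_comm, reassoc_of% hl₁]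
  · rw [← cancel_epi F.f₀, ← reassoc_of% F.u_comm, hl₁, G.u_comm, reassoc_of% hl₀]
  · -- over a cover, the pair `(g, f)` lifts to a composable pair of `A`
    obtain ⟨T', e, a, b, he, ha, hb, hab⟩ := hC.exists_composable_lift B.i_s B.i_i h₁ F.s_comm
      F.u_comm (i_comm F) g f h
    rw [← cancel_epi e, precomp_comp, ← Category.assoc, precomp_comp,
      comp_congr ha.symm hb.symm, ← comp_map _ _ _ hab, Category.assoc, hl₁, comp_map]
    refine comp_congr ?_ ?_ _
    · rw [← hl₁, reassoc_of% ha]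
    · rw [← hl₁, reassoc_of% hb]

lemma components_of_isRegularEpi (hC : IsGoursat C) (F : A ⟶ B) (h : IsRegularEpi F) :
    IsRegularEpi F.f₀ ∧ IsRegularEpi F.f₁ := by
  obtain ⟨I, E, N, h₀, h₁, hN, rfl⟩ := exists_image_fac hC F
  have : IsIso N := ExtremalEpi.isIso (E ≫ N) E N rfl
  have i₀ : IsIso N.f₀ := inferInstanceAs (IsIso ((ob C).map N))
  have i₁ : IsIso N.f₁ := inferInstanceAs (IsIso ((mor C).map N))
  exact ⟨isRegularEpi_comp _ _ h₀ inferInstance, isRegularEpi_comp _ _ h₁ inferInstance⟩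

theorem regular_of_isGoursat (hC : IsGoursat C) : Regular (InternalGroupoid C) where
  hasCoequalizer_of_isKernelPair {A B K F G₁ G₂} hK := by
    obtain ⟨I, E, N, h₀, h₁, hN, rfl⟩ := exists_image_fac hC F
    have hE := isRegularEpi_of_components hC E h₀ h₁
    -- `N` is a monomorphism, so `F` and the regular epimorphism `E` have the same kernel pair
    exact ⟨⟨_, hK.cancel_right_of_mono.toCoequalizer'⟩⟩
  regularEpiIsStableUnderBaseChange :=
    { of_isPullback := fun {A B D K F G F' G'} sq hG => by
        obtain ⟨h₀, h₁⟩ := components_of_isRegularEpi hC _ hG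
        exact isRegularEpi_of_components hC _
          (Regular.regularEpiIsStableUnderBaseChange.of_isPullback (sq.map (ob C)) h₀)
          (Regular.regularEpiIsStableUnderBaseChange.of_isPullback (sq.map (mor C)) h₁) }

end InternalGroupoid

/-! ### The Goursat property for internal groupoids -/

/-- Given a finite limit preserving functor to a Goursat category, the object of chains
`x S y' R z' S w` over `T` is sent to a cover of the image of `T` whenever `T` carries
a chain `x R y S z R w`. -/
lemma IsGoursat.isRegularEpi_map_chains (hC : IsGoursat C) {D : Type*} [Category* D]
    [HasFiniteLimits D] (Φ : D ⥤ C) [PreservesFiniteLimits Φ] {X R S T : D} {p₁ p₂ : R ⟶ X}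
    {q₁ q₂ : S ⟶ X} (hp : IsEquivalenceRelation p₁ p₂) (hq : IsEquivalenceRelation q₁ q₂)
    {x y z w : T ⟶ X} (hxy : Related p₁ p₂ x y) (hyz : Related q₁ q₂ y z)
    (hzw : Related p₁ p₂ z w) :
    IsRegularEpi (Φ.map (pullback.fst (prod.lift x w) (prod.lift
      (pullback.fst (pullback.snd q₂ p₁ ≫ p₂) q₁ ≫ pullback.fst q₂ p₁ ≫ q₁)
      (pullback.snd (pullback.snd q₂ p₁ ≫ p₂) q₁ ≫ q₂)))) := by
  obtain ⟨U, e, y', z', he, ⟨a, ha₁, ha₂⟩, ⟨b, hb₁, hb₂⟩, ⟨c, hc₁, hc₂⟩⟩ := isGoursat_iff.1 hC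
    _ _ _ _ (hp.map Φ) (hq.map Φ) _ _ _ _ (hxy.map Φ) (hyz.map Φ) (hzw.map Φ)
  obtain ⟨k, hk₁, hk₂⟩ := ((IsPullback.of_hasPullback q₂ p₁).map Φ).exists_lift a b
    (ha₂.trans hb₁.symm)
  obtain ⟨l, hl₁, hl₂⟩ :=
    ((IsPullback.of_hasPullback (pullback.snd q₂ p₁ ≫ p₂) q₁).map Φ).exists_lift k c
      (by rw [Φ.map_comp, reassoc_of% hk₂, hb₂, hc₁])
  obtain ⟨d, hd, -⟩ := ((IsPullback.of_hasPullback (prod.lift x w) (prod.lift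
      (pullback.fst (pullback.snd q₂ p₁ ≫ p₂) q₁ ≫ pullback.fst q₂ p₁ ≫ q₁)
      (pullback.snd (pullback.snd q₂ p₁ ≫ p₂) q₁ ≫ q₂))).map Φ).exists_lift e l (by
    refine map_prod_hom_ext Φ ?_ ?_
    · simp only [Category.assoc, ← Φ.map_comp, prod.lift_fst]
      simp only [Φ.map_comp, reassoc_of% hl₁, reassoc_of% hk₁, ha₁]
    · simp only [Category.assoc, ← Φ.map_comp, prod.lift_snd]
      simp only [Φ.map_comp, reassoc_of% hl₂, hc₂])
  exact isRegularEpi_of_comp d _ (by rwa [hd])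

namespace InternalGroupoid

theorem isGoursat_of_isGoursat (hC : IsGoursat C) [Regular (InternalGroupoid C)] :
    IsGoursat (InternalGroupoid C) := by
  refine isGoursat_iff.2 fun X R S p₁ p₂ q₁ q₂ hp hq T x y z w hxy hyz hzw => ?_
  -- `l` and `r` are the end points of the universal chain `S`, `R`, `S`; the cover of `T` consists
  -- of the chains from `x` to `w`
  let l := pullback.fst (pullback.snd q₂ p₁ ≫ p₂) q₁ ≫ pullback.fst q₂ p₁ ≫ q₁
  let r := pullback.snd (pullback.snd q₂ p₁ ≫ p₂) q₁ ≫ q₂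
  let k := pullback.snd (prod.lift x w) (prod.lift l r)
  have hk : pullback.fst (prod.lift x w) (prod.lift l r) ≫ prod.lift x w = k ≫ prod.lift l r :=
    pullback.condition
  rw [prod.comp_lift, prod.comp_lift, prod_lift_ext_iff, prod.lift_fst, prod.lift_snd] at hk
  refine ⟨_, pullback.fst (prod.lift x w) (prod.lift l r),
    k ≫ pullback.fst _ _ ≫ pullback.fst _ _ ≫ q₂, k ≫ pullback.snd _ _ ≫ q₁,
    isRegularEpi_of_components hC _ (hC.isRegularEpi_map_chains (ob C) hp hq hxy hyz hzw)
      (hC.isRegularEpi_map_chains (mor C) hp hq hxy hyz hzw), ?_, ?_, ?_⟩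
  · exact ⟨k ≫ pullback.fst _ _ ≫ pullback.fst _ _, by simp [hk.1, l], by simp⟩
  · exact ⟨k ≫ pullback.fst _ _ ≫ pullback.snd _ _, by simp [pullback.condition],
      by simp [← pullback.condition]⟩
  · exact ⟨k ≫ pullback.snd _ _, by simp, by simp [hk.2, r]⟩

/-- The object-of-objects functor is a left adjoint, so it preserves regular epimorphisms. -/
lemma isRegularEpi_f₀ {A B : InternalGroupoid C} (F : A ⟶ B) (h : IsRegularEpi F) :
    IsRegularEpi F.f₀ := by
  obtain ⟨⟨r⟩⟩ := h
  have := obAdjunction (C := C).leftAdjoint_preservesColimits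
  exact ⟨⟨
    { W := (ob C).obj r.W
      left := (ob C).map r.left
      right := (ob C).map r.right
      w := congr($(r.w).f₀)
      isColimit := isColimitCoforkMapOfIsColimit (ob C) r.w r.isColimit }⟩⟩

/-- The Goursat property descends along the codiscrete groupoid functor. -/
theorem isGoursat_of_isGoursat_internalGroupoid [Regular (InternalGroupoid C)]
    (h : IsGoursat (InternalGroupoid C)) : IsGoursat C := by
  refine isGoursat_iff.2 fun X R S p₁ p₂ q₁ q₂ hp hq T x y z w hxy hyz hzw => ?_
  have : PreservesLimits (codiscFunctor C) := obAdjunction.rightAdjoint_preservesLimits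
  have := PreservesLimits.preservesFiniteLimits (codiscFunctor C)
  obtain ⟨T', e, y', z', he, h₁, h₂, h₃⟩ := isGoursat_iff.1 h _ _ _ _ (hp.map (codiscFunctor C))
    (hq.map (codiscFunctor C)) _ _ _ _ (hxy.map (codiscFunctor C)) (hyz.map (codiscFunctor C))
    (hzw.map (codiscFunctor C))
  exact ⟨T'.X₀, e.f₀, y'.f₀, z'.f₀, isRegularEpi_f₀ e he, h₁.map (ob C), h₂.map (ob C),
    h₃.map (ob C)⟩

end InternalGroupoid

end Goursat

theorem mainTheorem9 {C : Type u} [Category.{v} C] [Regular C] :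
    IsGoursat C ↔ ∃ _ : Regular (InternalGroupoid C), IsGoursat (InternalGroupoid C) :=
  ⟨fun h =>
    have := InternalGroupoid.regular_of_isGoursat h
    ⟨this, InternalGroupoid.isGoursat_of_isGoursat h⟩,
    fun ⟨_, h⟩ => InternalGroupoid.isGoursat_of_isGoursat_internalGroupoid h⟩
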